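/- Fix $k\ge 1$ and a $k$-sided die whose sides have probabilities $p_1,\dots,p_k>0$ with $\sum_i p_i=1$. **The $n$-token game.** Each of two players chooses an allocation $\vec\xi\in\mathbb{Z}_{\ge 0}^k$ with $\sum_i \xi_i=n$, i.e. places $\xi_i$ tokens in his bin $i$. The die is thrown repeatedly and independently, and the same throws are used for both players; an outcome $i$ removes one token from bin $i$ of each player (nothing is removed from an empty bin). Let $T_{\vec\xi}$ be the number of throws until all tokens of the allocation $\vec\xi$ have been removed, and put $$K_n(\vec\xi,\vec\eta)=\tfrac12\bigl(\Pr[T_{\vec\xi}<T_{\vec\eta}]-\Pr[T_{\vec\eta}<T_{\vec\xi}]\bigr).$$ For $n\ge 1$, identify $\vec\xi$ with the normalized allocation $\vec x$ given by $\xi_i=p_i n+x_i\sqrt n$, let $A_n\subset\mathbb{R}^k$ be the finite set of normalized allocations, and regard $K_n$ as a function on $A_n\times A_n$. A mixed strategy $\alpha_n$ of the $n$-token game is a probability measure on $A_n$, and $K_n(\alpha_n,\vec y)=\int K_n(\vec x,\vec y)\,\alpha_n(d\vec x)$. **The continuous game.** Allocations are vectors $\vec x\in\mathbb{R}^k$ with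 $\sum_i x_i=0$. Let $Z_1,\dots,Z_k$ be independent standard normal random variables, $T_{\vec x}=\max_i\bigl(x_i/p_i+Z_i/\sqrt{p_i}\bigr)$ (with the same $Z_i$ for both players), and $$K(\vec x,\vec y)=\tfrac12\bigl(\Pr[T_{\vec x}<T_{\vec y}]-\Pr[T_{\vec y}<T_{\vec x}]\bigr).$$ A mixed strategy $\alpha$ is a Borel probability measure on $\mathbb{R}^k$ concentrated on $\{\vec x:\sum_i x_i=0\}$, and $K(\alpha,\vec y)=\int K(\vec x,\vec y)\,\alpha(d\vec x)$. **Theorem 4.1.** For each $n\ge1$ let $\alpha_n$ be a mixed strategy of the $n$-token game, and let $\tilde\alpha$ be a mixed strategy of the continuous game with bounded support each of whose $k$ one-dimensional marginals has no atoms. If $\alpha_n\to\tilde\alpha$ weakly as probability measures on $\mathbb{R}^k$, then $$\liminf_{n\to\infty}\ \min_{\vec y\in A_n}K_n(\alpha_n,\vec y)\ \ge\ \inf_{\vec y\,:\,\sum_i y_i=0}K(\tilde\alpha,\vec y).$$ -/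

import Mathlib

open MeasureTheory ProbabilityTheory Filter Topology

noncomputable section

namespace KnockEmDown

/-- A `k`-sided die all of whose sides have positive probability: side `i` comes up with
probability `prob i`. -/
structure Die (k : ℕ) where
  prob : Fin k → ℝ
  prob_pos : ∀ i, 0 < prob i
  sum_prob : ∑ i, prob i = 1

namespace Die

variable {k : ℕ}

/-- The law of a single throw of the die. -/
def law (p : Die k) : Measure (Fin k) :=
  ∑ i, ENNReal.ofReal (p.prob i) • Measure.dirac i

instance (p : Die k) : IsProbabilityMeasure p.law := by
  constructor
  simp only [law, Measure.coe_finsetSum, Finset.sum_apply, Measure.smul_apply, measure_univ,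
    smul_eq_mul, mul_one]
  rw [← ENNReal.ofReal_sum_of_nonneg fun i _ => (p.prob_pos i).le, p.sum_prob, ENNReal.ofReal_one]

/-- The law of an infinite sequence of independent throws of the die. -/
def throwsLaw (p : Die k) : Measure (ℕ → Fin k) :=
  Measure.infinitePi fun _ : ℕ => p.law

theorem nonempty_sides (p : Die k) : Nonempty (Fin k) := by
  by_contra h
  rw [not_nonempty_iff] at h
  simpa using p.sum_prob

end Die

/-! ### The game with `n` tokens -/

/-- The allocations (pure strategies) of the `n`-token game: `n` tokens are arranged in `k` bins. -/
abbrev Allocation (k n : ℕ) : Type := {ξ : Fin k → ℕ // ∑ i, ξ i = n}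

/-- The contents of the bins after `t` throws, when the bins initially contain `ξ` and the
successive throws are `ω 0, ω 1, …`. A throw with outcome `i` knocks down one token of bin `i`, if
there is one (the subtraction of natural numbers is truncated: `0 - 1 = 0`). -/
def remaining {k : ℕ} (ω : ℕ → Fin k) (ξ : Fin k → ℕ) : ℕ → Fin k → ℕ
  | 0 => ξ
  | t + 1 => fun i => if ω t = i then remaining ω ξ t i - 1 else remaining ω ξ t i

/-- The clearance time: the number of throws after which all the tokens have been knocked down
(`⊤` if this never happens, which is an event of probability zero). -/
def clearanceTime {k : ℕ} (ω : ℕ → Fin k) (ξ : Fin k → ℕ) : ℕ∞ :=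
  ⨅ t : {t : ℕ // ∀ i, remaining ω ξ t i = 0}, ((t : ℕ) : ℕ∞)

/-- The payoff `K_n(ξ, η) = (Pr[T_ξ < T_η] - Pr[T_η < T_ξ]) / 2` of the `n`-token game to a player
who plays the allocation `ξ` against the allocation `η`; the same throws are used for both. -/
def payoff {k n : ℕ} (p : Die k) (ξ η : Allocation k n) : ℝ :=
  (p.throwsLaw.real {ω | clearanceTime ω ξ.1 < clearanceTime ω η.1} -
    p.throwsLaw.real {ω | clearanceTime ω η.1 < clearanceTime ω ξ.1}) / 2

/-- The payoff `K_n(α, η)` of the mixed strategy `α` against the allocation `η`. -/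
def mixedPayoff {k n : ℕ} (p : Die k) (α : ProbabilityMeasure (Allocation k n))
    (η : Allocation k n) : ℝ :=
  ∫ ξ, payoff p ξ η ∂(α : Measure (Allocation k n))

/-- The worst-case payoff `min_η K_n(α, η)` of the mixed strategy `α`. There are finitely many
allocations `η`, and at least one, so that the infimum is a minimum; see
`exists_mixedPayoff_eq_worstPayoff`. -/
def worstPayoff {k n : ℕ} (p : Die k) (α : ProbabilityMeasure (Allocation k n)) : ℝ :=
  ⨅ η : Allocation k n, mixedPayoff p α η

instance (k n : ℕ) : Finite (Allocation k n) :=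
  Set.Finite.to_subtype <| (Finset.finite_toSet (Finset.piAntidiag Finset.univ n)).subset
    fun ξ (hξ : ∑ i, ξ i = n) => by simpa using hξ

theorem exists_mixedPayoff_eq_worstPayoff {k n : ℕ} (p : Die k)
    (α : ProbabilityMeasure (Allocation k n)) :
    ∃ η, mixedPayoff p α η = worstPayoff p α ∧ ∀ η', mixedPayoff p α η ≤ mixedPayoff p α η' := by
  obtain ⟨i⟩ := p.nonempty_sides
  have : Nonempty (Allocation k n) := ⟨⟨Pi.single i n, by simp⟩⟩
  obtain ⟨η, hη⟩ := Finite.exists_min (mixedPayoff p α)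
  exact ⟨η, le_antisymm (le_ciInf hη) (ciInf_le (Set.finite_range _).bddBelow η), hη⟩

/-- The normalized allocation `x` belonging to `ξ`, so that `ξ_i = p_i n + x_i √n` for `n ≥ 1`. -/
def normalized {k n : ℕ} (p : Die k) (ξ : Allocation k n) : Fin k → ℝ :=
  fun i => ((ξ.1 i : ℝ) - p.prob i * n) / √(n : ℝ)

theorem measurable_normalized {k n : ℕ} (p : Die k) :
    Measurable (normalized p : Allocation k n → Fin k → ℝ) :=
  Measurable.of_discrete

/-- A mixed strategy of the `n`-token game, regarded as a probability measure on normalized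
allocations. -/
def normalizedStrategy {k n : ℕ} (p : Die k) (α : ProbabilityMeasure (Allocation k n)) :
    ProbabilityMeasure (Fin k → ℝ) :=
  α.map (measurable_normalized p).aemeasurable

/-! ### The continuous game -/

/-- The allocations (pure strategies) of the continuous game: real vectors with vanishing sum. -/
abbrev ContAllocation (k : ℕ) : Type := {x : Fin k → ℝ // ∑ i, x i = 0}

/-- The clearance time `T_x = max_i (x_i / p_i + z_i / √p_i)` of the continuous game. -/
def contClearanceTime {k : ℕ} (p : Die k) (z x : Fin k → ℝ) : ℝ :=
  ⨆ i, (x i / p.prob i + z i / √(p.prob i))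

/-- The payoff `K(x, y) = (Pr[T_x < T_y] - Pr[T_y < T_x]) / 2` of the continuous game, where the
same independent standard normal variables `z_i` are used for both players. -/
def contPayoff {k : ℕ} (p : Die k) (x y : Fin k → ℝ) : ℝ :=
  ((Measure.pi fun _ : Fin k => gaussianReal 0 1).real
      {z | contClearanceTime p z x < contClearanceTime p z y} -
    (Measure.pi fun _ : Fin k => gaussianReal 0 1).real
      {z | contClearanceTime p z y < contClearanceTime p z x}) / 2

/-- The payoff `K(α, y)` of the mixed strategy `α` against the allocation `y`. -/
def contMixedPayoff {k : ℕ} (p : Die k) (α : ProbabilityMeasure (Fin k → ℝ))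
    (y : Fin k → ℝ) : ℝ :=
  ∫ x, contPayoff p x y ∂(α : Measure (Fin k → ℝ))

/-- A mixed strategy of the continuous game is a probability measure on `ℝ^k` that is concentrated
on the vectors with vanishing sum. -/
def IsContStrategy {k : ℕ} (α : ProbabilityMeasure (Fin k → ℝ)) : Prop :=
  ∀ᵐ x ∂(α : Measure (Fin k → ℝ)), ∑ i, x i = 0

/-- All the one-dimensional marginals of `α` are atomless. -/
def HasAtomlessMarginals {k : ℕ} (α : ProbabilityMeasure (Fin k → ℝ)) : Prop :=
  ∀ i, ∀ c : ℝ, (α : Measure (Fin k → ℝ)).map (fun x => x i) {c} = 0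

end KnockEmDown

end

/-!
The law of large numbers and the central limit theorem turn the `n`-token game into the continuous
one. After `n + s √n` throws, the normalized number of outcomes `i` is `p_i s + g_i` up to an error
that vanishes in probability (Chebyshev's inequality, `tendsto_measure_scaledHits_sub`), where `g`
is the normalized vector of counts after `n` throws. By the central limit theorem
(`tendsto_scaledHitsLaw`), `g` converges in law to `p_i ∑_j √p_j Z_j - √p_i Z_i`
(`countLimit`). Against these limiting counts an allocation `x` is cleared at time
`max_i (x_i - g_i) / p_i`, which is the clearance time of the continuous game up to a shift that is
the same for both players.

Only a lower bound for the probability of winning is needed. Indeed `K_n ≥ Pr[win] - 1/2` always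
holds, while `K(α', y) = Pr[win] - 1/2`: since the marginals of `α'` have no atoms, ties have
probability zero (`contMixedPayoff_eq`). The lower bound is a matter of open sets: a win is
witnessed by a single time at which one's own bins are empty and some bin `i` of the opponent is
not. For the limiting counts such an event with rational time `s`, rational level `c < y_i` and
positive margin is open (`Window.event`), countably many of them exhaust the event of winning, and
finitely many give its probability up to an arbitrarily small error. The portmanteau theorem,
applied to the product of `α_n` with the law of the counts, then bounds the probability of winning
the `n`-token game (`eventually_lt_mixedPayoff`).

The opponent's reply may depend on `n`. Along an ultrafilter its normalization either converges to
some `y` with vanishing sum, and the payoff is eventually above every number below `K(α', y)`, or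
some coordinate tends to `∞`, and then the payoff is eventually above every number below `1/2`,
because the windows of that bin cover everything (`exists_tendsto_or_tendsto_atTop`).
-/

open MeasureTheory ProbabilityTheory Filter Topology

noncomputable section

namespace KnockEmDown

/-! ### Clearance times and counts of outcomes -/

/-- The number of times that side `i` comes up among the first `t` throws `ω 0, …, ω (t - 1)`. -/
def hits {k : ℕ} (ω : ℕ → Fin k) (t : ℕ) (i : Fin k) : ℕ :=
  ∑ s ∈ Finset.range t, if ω s = i then 1 else 0

theorem remaining_eq_sub_hits {k : ℕ} (ω : ℕ → Fin k) (ξ : Fin k → ℕ) (t : ℕ) (i : Fin k) :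
    remaining ω ξ t i = ξ i - hits ω t i := by
  induction t with
  | zero => simp [remaining, hits]
  | succ t ih =>
    simp only [remaining, ih, hits, Finset.sum_range_succ]
    split_ifs <;> omega

theorem hits_mono {k : ℕ} (ω : ℕ → Fin k) (i : Fin k) : Monotone fun t => hits ω t i :=
  fun _ _ h => Finset.sum_le_sum_of_subset (Finset.range_mono h)

/-- One time at which `ξ` is cleared and `η` is not witnesses `T_ξ < T_η`. -/
theorem clearanceTime_lt_of_hits {k : ℕ} {ω : ℕ → Fin k} {ξ η : Fin k → ℕ} (t : ℕ)
    (hξ : ∀ j, ξ j ≤ hits ω t j) {i : Fin k} (hη : hits ω t i < η i) :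
    clearanceTime ω ξ < clearanceTime ω η := by
  have h₁ : clearanceTime ω ξ ≤ t :=
    iInf_le (fun t : {t : ℕ // ∀ i, remaining ω ξ t i = 0} => ((t : ℕ) : ℕ∞))
      ⟨t, fun j => by rw [remaining_eq_sub_hits]; exact Nat.sub_eq_zero_of_le (hξ j)⟩
  have h₂ : ((t + 1 : ℕ) : ℕ∞) ≤ clearanceTime ω η := by
    refine le_iInf fun u => ?_
    have hu := u.2 i
    rw [remaining_eq_sub_hits] at hu
    have : t < u.1 := by
      by_contra! h
      have := hits_mono ω i h
      dsimp only at this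
      omega
    exact_mod_cast this
  exact h₁.trans_lt ((by exact_mod_cast Nat.lt_succ_self t : (t : ℕ∞) < ((t + 1 : ℕ) : ℕ∞)).trans_le
    h₂)

instance {k : ℕ} (p : Die k) : IsProbabilityMeasure p.throwsLaw := by
  unfold Die.throwsLaw; infer_instance

/-- Ties and clearance times that fail to be measurable do no harm: a measurable event on which
`ξ` wins bounds the probability that `ξ` loses as well. -/
theorem measureReal_sub_half_le_payoff {k n : ℕ} (p : Die k) (ξ η : Allocation k n)
    {E : Set (ℕ → Fin k)} (hE : MeasurableSet E)
    (h : ∀ ω ∈ E, clearanceTime ω ξ.1 < clearanceTime ω η.1) :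
    p.throwsLaw.real E - 1 / 2 ≤ payoff p ξ η := by
  have h₁ : p.throwsLaw.real E ≤
      p.throwsLaw.real {ω | clearanceTime ω ξ.1 < clearanceTime ω η.1} := measureReal_mono h
  have h₂ : p.throwsLaw.real {ω | clearanceTime ω η.1 < clearanceTime ω ξ.1} ≤
      p.throwsLaw.real Eᶜ := measureReal_mono fun ω hω hωE => lt_asymm hω (h ω hωE)
  rw [probReal_compl_eq_one_sub hE] at h₂
  unfold payoff
  linarith

/-! ### Moments of a single throw -/

namespace Die

variable {k : ℕ} (p : Die k)

theorem integral_law (f : Fin k → ℝ) : ∫ i, f i ∂p.law = ∑ i, p.prob i * f i := by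
  have (i : Fin k) : IsFiniteMeasure (ENNReal.ofReal (p.prob i) • Measure.dirac i) :=
    Measure.smul_finite _ ENNReal.ofReal_ne_top
  rw [law, integral_finsetSum_measure fun _ _ => Integrable.of_finite]
  refine Finset.sum_congr rfl fun i _ => ?_
  rw [integral_smul_measure, integral_dirac, ENNReal.toReal_ofReal (p.prob_pos i).le, smul_eq_mul]

theorem variance_law (f : Fin k → ℝ) :
    Var[f; p.law] = ∑ i, p.prob i * (f i - ∑ j, p.prob j * f j) ^ 2 := by
  rw [variance_eq_integral Measurable.of_discrete.aemeasurable, integral_law, integral_law]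

theorem prob_le_one (i : Fin k) : p.prob i ≤ 1 :=
  p.sum_prob ▸ Finset.single_le_sum (fun j _ => (p.prob_pos j).le) (Finset.mem_univ i)

theorem measurePreserving_throw (t : ℕ) :
    MeasurePreserving (fun ω : ℕ → Fin k => ω t) p.throwsLaw p.law :=
  measurePreserving_eval_infinitePi (fun _ => p.law) t

theorem iIndepFun_throws (f : Fin k → ℝ) :
    iIndepFun (fun (t : ℕ) (ω : ℕ → Fin k) => f (ω t)) p.throwsLaw :=
  iIndepFun_infinitePi (P := fun _ => p.law) (X := fun _ => f) fun _ => Measurable.of_discrete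

theorem identDistrib_throws (f : Fin k → ℝ) (s t : ℕ) :
    IdentDistrib (fun ω : ℕ → Fin k => f (ω s)) (fun ω => f (ω t)) p.throwsLaw p.throwsLaw := by
  have hf : Measurable f := Measurable.of_discrete
  refine IdentDistrib.comp (u := f) 
    ⟨(measurable_pi_apply s).aemeasurable, (measurable_pi_apply t).aemeasurable, ?_⟩ hf
  rw [(p.measurePreserving_throw s).map_eq, (p.measurePreserving_throw t).map_eq]

theorem memLp_throw (f : Fin k → ℝ) (t : ℕ) :
    MemLp (fun ω : ℕ → Fin k => f (ω t)) 2 p.throwsLaw :=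
  (MemLp.of_discrete (f := f) (μ := p.law)).comp_measurePreserving (p.measurePreserving_throw t)

theorem integral_throw (f : Fin k → ℝ) (t : ℕ) :
    ∫ ω, f (ω t) ∂p.throwsLaw = ∑ i, p.prob i * f i := by
  rw [← integral_law, ← (p.measurePreserving_throw t).map_eq,
    integral_map (measurable_pi_apply t).aemeasurable
      Measurable.of_discrete.aestronglyMeasurable]

theorem variance_throw (f : Fin k → ℝ) (t : ℕ) :
    Var[fun ω : ℕ → Fin k => f (ω t); p.throwsLaw] =
      ∑ i, p.prob i * (f i - ∑ j, p.prob j * f j) ^ 2 := by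
  rw [← variance_law, ← (p.measurePreserving_throw t).map_eq]
  exact (variance_map Measurable.of_discrete.aemeasurable
    (measurable_pi_apply t).aemeasurable).symm

end Die

/-! ### Concentration of the counts over short times -/

@[fun_prop]
theorem measurable_hits {k : ℕ} (t : ℕ) (i : Fin k) :
    Measurable fun ω : ℕ → Fin k => hits ω t i := by
  unfold hits
  refine Finset.measurable_fun_sum _ fun s _ => ?_
  exact (Measurable.of_discrete (f := fun j : Fin k => if j = i then 1 else 0)).comp
    (measurable_pi_apply s)

theorem measure_le_abs_hits_sub_le {k : ℕ} (p : Die k) (i : Fin k) {a b : ℕ} (hab : a ≤ b) {c : ℝ}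
    (hc : 0 < c) :
    p.throwsLaw.real {ω | c ≤ |(hits ω b i : ℝ) - hits ω a i - p.prob i * (b - a)|} ≤
      (b - a) / c ^ 2 := by
  set f : Fin k → ℝ := fun j => if j = i then 1 else 0 with hf
  have hsum (ω : ℕ → Fin k) :
      (hits ω b i : ℝ) - hits ω a i = (∑ t ∈ Finset.Ico a b, fun ω : ℕ → Fin k => f (ω t)) ω := by
    rw [Finset.sum_apply, Finset.sum_Ico_eq_sub _ hab]
    simp [hits, hf]
  have hmean : ∑ j, p.prob j * f j = p.prob i := by simp [hf]
  have hint : ∫ ω, (∑ t ∈ Finset.Ico a b, fun ω : ℕ → Fin k => f (ω t)) ω ∂p.throwsLaw =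
      p.prob i * (b - a) := by
    simp_rw [Finset.sum_apply]
    rw [integral_finsetSum _ fun t _ => (p.memLp_throw f t).integrable (by norm_num)]
    simp only [p.integral_throw, hmean, Finset.sum_const, Nat.card_Ico, nsmul_eq_mul]
    rw [Nat.cast_sub hab, mul_comm]
  have hvar1 (t : ℕ) : Var[fun ω : ℕ → Fin k => f (ω t); p.throwsLaw] ≤ 1 := by
    rw [p.variance_throw, hmean, ← p.sum_prob]
    refine Finset.sum_le_sum fun j _ => ?_
    have h0 := p.prob_pos i
    have h1 := p.prob_le_one i
    refine mul_le_of_le_one_right (p.prob_pos j).le ?_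
    simp only [hf]
    split_ifs <;> nlinarith
  have hvar : Var[∑ t ∈ Finset.Ico a b, fun ω : ℕ → Fin k => f (ω t); p.throwsLaw] ≤ b - a := by
    rw [IndepFun.variance_sum (fun t _ => p.memLp_throw f t)
      fun s _ t _ hst => (p.iIndepFun_throws f).indepFun hst]
    refine (Finset.sum_le_card_nsmul _ _ 1 fun t _ => hvar1 t).trans ?_
    simp [Nat.cast_sub hab]
  have hcheb := meas_ge_le_variance_div_sq
    (memLp_finsetSum' (Finset.Ico a b) fun t _ => p.memLp_throw f t) hc
  rw [hint] at hcheb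
  simp_rw [hsum]
  refine (ENNReal.toReal_mono ENNReal.ofReal_ne_top hcheb).trans ?_
  rw [ENNReal.toReal_ofReal (div_nonneg (variance_nonneg _ _) (sq_nonneg c))]
  gcongr

theorem measure_le_abs_hits_sub_le' {k : ℕ} (p : Die k) (i : Fin k) (a b : ℕ) {c : ℝ}
    (hc : 0 < c) :
    p.throwsLaw.real {ω | c ≤ |(hits ω b i : ℝ) - hits ω a i - p.prob i * (b - a)|} ≤
      |(b : ℝ) - a| / c ^ 2 := by
  rcases le_total a b with h | h
  · refine (measure_le_abs_hits_sub_le p i h hc).trans ?_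
    gcongr
    exact le_abs_self _
  · have := measure_le_abs_hits_sub_le p i h hc
    rw [abs_sub_comm, abs_of_nonneg (sub_nonneg.2 (Nat.cast_le.2 h))]
    convert this using 5 with ω
    rw [← abs_neg]
    ring_nf

/-- The time `n + s √n`, rounded down. For negative `s` and small `n` this is truncated to `0`,
which does not affect limits. -/
def scaledTime (s : ℝ) (n : ℕ) : ℕ := ⌊(n : ℝ) + s * √n⌋₊

/-- The normalized counts after `t` throws, in the scale of the `n`-token game. -/
def scaledHits {k : ℕ} (p : Die k) (n t : ℕ) (ω : ℕ → Fin k) : Fin k → ℝ :=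
  fun i => ((hits ω t i : ℝ) - p.prob i * n) / √n

@[fun_prop]
theorem measurable_scaledHits {k : ℕ} (p : Die k) (n t : ℕ) : Measurable (scaledHits p n t) := by
  unfold scaledHits
  fun_prop

theorem tendsto_sqrt_natCast_atTop : Tendsto (fun n : ℕ => √(n : ℝ)) atTop atTop :=
  Real.tendsto_sqrt_atTop.comp tendsto_natCast_atTop_atTop

theorem tendsto_scaledTime (s : ℝ) :
    Tendsto (fun n : ℕ => ((scaledTime s n : ℝ) - n) / √n) atTop (𝓝 s) := by
  have hsqrt := tendsto_sqrt_natCast_atTop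
  refine tendsto_of_tendsto_of_tendsto_of_le_of_le' (g := fun n : ℕ => s - 1 / √(n : ℝ))
    (h := fun _ => s) ?_ tendsto_const_nhds ?_ ?_
  · simpa using tendsto_const_nhds.sub (hsqrt.inv_tendsto_atTop)
  · filter_upwards [eventually_gt_atTop 0] with n hn
    have h0 : 0 < √(n : ℝ) := Real.sqrt_pos.2 (Nat.cast_pos.2 hn)
    have := Nat.lt_floor_add_one ((n : ℝ) + s * √n)
    rw [le_div_iff₀ h0, sub_mul, one_div, inv_mul_cancel₀ h0.ne']
    unfold scaledTime
    linarith
  · filter_upwards [eventually_gt_atTop 0, hsqrt.eventually_ge_atTop (-s)] with n hn hs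
    have h0 : 0 < √(n : ℝ) := Real.sqrt_pos.2 (Nat.cast_pos.2 hn)
    have hnn : 0 ≤ (n : ℝ) + s * √n := by
      have := Real.mul_self_sqrt (Nat.cast_nonneg (α := ℝ) n)
      nlinarith
    have := Nat.floor_le hnn
    rw [div_le_iff₀ h0]
    unfold scaledTime
    linarith

/-- Between the times `n` and `n + s √n` the normalized counts move by the deterministic amount
`p s`, up to an error that vanishes in probability. -/
theorem tendsto_measure_scaledHits_sub {k : ℕ} (p : Die k) (i : Fin k) (s : ℝ) {ε : ℝ}
    (hε : 0 < ε) :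
    Tendsto (fun n => p.throwsLaw.real {ω | ε ≤ |scaledHits p n (scaledTime s n) ω i -
      (p.prob i * s + scaledHits p n n ω i)|}) atTop (𝓝 0) := by
  have hd := tendsto_scaledTime s
  have hlim : Tendsto (fun n : ℕ => |((scaledTime s n : ℝ) - n) / √n| / (ε / 2) ^ 2 * (√(n : ℝ))⁻¹)
      atTop (𝓝 0) := by
    simpa using (hd.abs.div_const ((ε / 2) ^ 2)).mul tendsto_sqrt_natCast_atTop.inv_tendsto_atTop
  refine tendsto_of_tendsto_of_tendsto_of_le_of_le' tendsto_const_nhds hlim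
    (Eventually.of_forall fun _ => measureReal_nonneg) ?_
  have hclose : ∀ᶠ n : ℕ in atTop, |((scaledTime s n : ℝ) - n) / √n - s| < ε / 2 := by
    have := Metric.tendsto_nhds.1 hd (ε / 2) (by positivity)
    simpa [Real.dist_eq] using this
  filter_upwards [hclose, eventually_gt_atTop 0] with n hn hn0
  have h0 : 0 < √(n : ℝ) := Real.sqrt_pos.2 (Nat.cast_pos.2 hn0)
  have hsq : √(n : ℝ) ^ 2 = n := Real.sq_sqrt (Nat.cast_nonneg n)
  have hcheb := measure_le_abs_hits_sub_le' p i n (scaledTime s n) (c := ε / 2 * √n) (by positivity)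
  refine (measureReal_mono (fun ω hω => ?_)).trans (hcheb.trans_eq ?_)
  · simp only [Set.mem_ofPred_eq] at hω ⊢
    set A := (hits ω (scaledTime s n) i : ℝ) - hits ω n i - p.prob i * (scaledTime s n - n) with hA
    have heq : scaledHits p n (scaledTime s n) ω i - (p.prob i * s + scaledHits p n n ω i) =
        A / √n + p.prob i * (((scaledTime s n : ℝ) - n) / √n - s) := by
      simp only [scaledHits, hA]
      field_simp
      ring
    rw [heq] at hω
    have h₂ : |p.prob i * (((scaledTime s n : ℝ) - n) / √n - s)| ≤ ε / 2 := by
      rw [abs_mul, abs_of_pos (p.prob_pos i)]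
      exact (mul_le_of_le_one_left (abs_nonneg _) (p.prob_le_one i)).trans hn.le
    have h₃ := abs_add_le (A / √n) (p.prob i * (((scaledTime s n : ℝ) - n) / √n - s))
    have h₄ : ε / 2 ≤ |A / √n| := by linarith
    rwa [abs_div, abs_of_pos h0, le_div_iff₀ h0] at h₄
  · rw [abs_div, abs_of_pos h0]
    field_simp

/-! ### The central limit theorem for the counts -/

/-- The linear map that turns independent standard normal variables `z` into the Gaussian limit of
the normalized counts: `g_i = p_i ∑_j √p_j z_j - √p_i z_i`. The first term is the same for all
players and, divided by `p_i`, for all bins, so it only shifts the clearance times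
`max_i (x_i - g_i) / p_i`. -/
def countLimit {k : ℕ} (p : Die k) (z : Fin k → ℝ) : Fin k → ℝ :=
  fun i => p.prob i * ∑ j, √(p.prob j) * z j - √(p.prob i) * z i

@[fun_prop]
theorem measurable_countLimit {k : ℕ} (p : Die k) : Measurable (countLimit p) := by
  unfold countLimit
  fun_prop

/-- The law of the vector of independent standard normal variables in the continuous game. -/
abbrev stdNormal (k : ℕ) : Measure (Fin k → ℝ) := Measure.pi fun _ : Fin k => gaussianReal 0 1

theorem sum_mul_hits {k : ℕ} (f : Fin k → ℝ) (ω : ℕ → Fin k) (n : ℕ) :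
    ∑ i, f i * hits ω n i = ∑ t ∈ Finset.range n, f (ω t) := by
  simp only [hits, Nat.cast_sum, Finset.mul_sum]
  rw [Finset.sum_comm]
  simp

theorem inner_scaledHits {k : ℕ} (p : Die k) (f : Fin k → ℝ) (ω : ℕ → Fin k) (n : ℕ) :
    ∑ i, f i * scaledHits p n n ω i =
      (√(n : ℝ))⁻¹ * (∑ t ∈ Finset.range n, f (ω t) - n * ∑ i, p.prob i * f i) := by
  rw [← sum_mul_hits, Finset.mul_sum, ← Finset.sum_sub_distrib, Finset.mul_sum]
  refine Finset.sum_congr rfl fun i _ => ?_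
  simp only [scaledHits]
  ring

theorem inner_countLimit {k : ℕ} (p : Die k) (f z : Fin k → ℝ) :
    ∑ i, f i * countLimit p z i =
      ∑ i, (√(p.prob i) * (∑ j, p.prob j * f j - f i)) * z i := by
  simp only [countLimit, mul_sub, sub_mul, Finset.sum_sub_distrib]
  congr 1
  · rw [Finset.sum_congr rfl fun i _ => (by ring : f i * (p.prob i * ∑ j, √(p.prob j) * z j) =
      (p.prob i * f i) * ∑ j, √(p.prob j) * z j), ← Finset.sum_mul, Finset.mul_sum]
    exact Finset.sum_congr rfl fun i _ => by ring
  · exact Finset.sum_congr rfl fun i _ => by ring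

/-- A linear functional of `countLimit` is a linear combination of independent standard normal
variables, whose variance is that of the same functional of a single throw. -/
theorem charFun_countLimit {k : ℕ} (p : Die k) (f : EuclideanSpace ℝ (Fin k)) :
    charFun ((stdNormal k).map fun z => WithLp.toLp 2 (countLimit p z)) f =
      Complex.exp (-(∑ i, p.prob i * (f i - ∑ j, p.prob j * f j) ^ 2 : ℝ) / 2) := by
  set a : EuclideanSpace ℝ (Fin k) :=
    WithLp.toLp 2 fun i => √(p.prob i) * (∑ j, p.prob j * f j - f i) with ha
  have h : charFun ((stdNormal k).map fun z => WithLp.toLp 2 (countLimit p z)) f =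
      charFun ((stdNormal k).map (WithLp.toLp 2)) a := by
    rw [charFun_apply, charFun_apply, integral_map (by fun_prop) (by fun_prop),
      integral_map (by fun_prop) (by fun_prop)]
    simp only [PiLp.inner_apply, RCLike.inner_apply, conj_trivial]
    simp_rw [inner_countLimit p f, ha]
  rw [h, charFun_pi]
  simp_rw [charFun_gaussianReal, ← Complex.exp_sum]
  congr 1
  push_cast
  rw [← Finset.sum_neg_distrib, Finset.sum_div]
  refine Finset.sum_congr rfl fun i _ => ?_
  have hs : ((√(p.prob i) : ℝ) : ℂ) ^ 2 = (p.prob i : ℂ) := by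
    exact_mod_cast Real.sq_sqrt (p.prob_pos i).le
  simp only [ha]
  push_cast
  rw [mul_pow, hs]
  simp
  ring

/-- The one-dimensional central limit theorem, applied to the payments `f (ω t)`. -/
theorem tendsto_charFun_scaledHits {k : ℕ} (p : Die k) (f : EuclideanSpace ℝ (Fin k)) :
    Tendsto (fun n => charFun (p.throwsLaw.map fun ω => WithLp.toLp 2 (scaledHits p n n ω)) f)
      atTop (𝓝 (Complex.exp (-(∑ i, p.prob i * (f i - ∑ j, p.prob j * f j) ^ 2 : ℝ) / 2))) := by
  set v := ∑ i, p.prob i * (f i - ∑ j, p.prob j * f j) ^ 2 with hv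
  have hv0 : 0 ≤ v := Finset.sum_nonneg fun i _ => mul_nonneg (p.prob_pos i).le (sq_nonneg _)
  have hclt := tendstoInDistribution_inv_sqrt_mul_sum_sub (P := p.throwsLaw)
    (X := fun t ω => f (ω t)) (P' := gaussianReal 0 v.toNNReal) (Y := id)
    ⟨aemeasurable_id, by rw [p.variance_throw, Measure.map_id]⟩
    (p.memLp_throw f 0) (p.iIndepFun_throws f) fun t => p.identDistrib_throws f t 0
  have hlim := ProbabilityMeasure.tendsto_iff_tendsto_charFun.1 hclt.tendsto 1
  simp only [ProbabilityMeasure.coe_mk, Measure.map_id, charFun_gaussianReal] at hlim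
  convert hlim using 2 with n
  · rw [charFun_apply, charFun_apply, integral_map (by fun_prop) (by fun_prop),
      integral_map (hclt.forall_aemeasurable n) (by fun_prop)]
    simp only [PiLp.inner_apply, RCLike.inner_apply, conj_trivial, one_mul]
    simp_rw [inner_scaledHits p f, p.integral_throw]
  · congr 1
    simp [Real.coe_toNNReal _ hv0]
    ring

/-- The law of the normalized counts after `n` throws. -/
def scaledHitsLaw {k : ℕ} (p : Die k) (n : ℕ) : ProbabilityMeasure (Fin k → ℝ) :=
  ⟨p.throwsLaw.map (scaledHits p n n),
    Measure.isProbabilityMeasure_map (measurable_scaledHits p n n).aemeasurable⟩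

/-- The limit of the laws of the normalized counts. -/
def countLimitLaw {k : ℕ} (p : Die k) : ProbabilityMeasure (Fin k → ℝ) :=
  ⟨(stdNormal k).map (countLimit p),
    Measure.isProbabilityMeasure_map (measurable_countLimit p).aemeasurable⟩

theorem tendsto_scaledHitsLaw {k : ℕ} (p : Die k) :
    Tendsto (scaledHitsLaw p) atTop (𝓝 (countLimitLaw p)) := by
  have h : TendstoInDistribution (fun n ω => WithLp.toLp 2 (scaledHits p n n ω)) atTop
      (fun z => WithLp.toLp 2 (countLimit p z)) (fun _ => p.throwsLaw) (stdNormal k) := by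
    refine ⟨fun n => by fun_prop, by fun_prop, ?_⟩
    refine ProbabilityMeasure.tendsto_iff_tendsto_charFun.2 fun f => ?_
    simp only [ProbabilityMeasure.coe_mk]
    rw [charFun_countLimit]
    exact tendsto_charFun_scaledHits p f
  exact (h.continuous_comp (PiLp.continuous_ofLp 2 fun _ : Fin k => ℝ)).tendsto

/-! ### Winning windows -/

/-- The parameters of an elementary way of winning: the time at which it is inspected, the level
that the opponent's allocation exceeds, the margin, and the bin in which the opponent has tokens
left. -/
structure Window (k : ℕ) where
  time : ℝ
  level : ℝ
  margin : ℝ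
  bin : Fin k

/-- The pairs of an allocation `x` and limiting counts `g` for which, at the time given by the
window, all bins of `x` are empty, while an allocation with at least `level` tokens in bin `bin` is
not cleared; both with room to spare. -/
def Window.event {k : ℕ} (p : Die k) (q : Window k) : Set ((Fin k → ℝ) × (Fin k → ℝ)) :=
  {r | (∀ j, r.1 j + q.margin < p.prob j * q.time + r.2 j) ∧
    p.prob q.bin * q.time + r.2 q.bin + q.margin < q.level}

theorem Window.isOpen_event {k : ℕ} (p : Die k) (q : Window k) : IsOpen (q.event p) := by
  have h : q.event p = (⋂ j, {r : (Fin k → ℝ) × (Fin k → ℝ) |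
      r.1 j + q.margin < p.prob j * q.time + r.2 j}) ∩
      {r | p.prob q.bin * q.time + r.2 q.bin + q.margin < q.level} := by
    ext r; simp [Window.event]
  rw [h]
  exact (isOpen_iInter_of_finite fun j => isOpen_lt (by fun_prop) (by fun_prop)).inter
    (isOpen_lt (by fun_prop) (by fun_prop))

/-- The throws for which the counts at the time of the window differ by at least the margin from
what the counts after `n` throws predict. -/
def Window.bad {k : ℕ} (p : Die k) (n : ℕ) (q : Window k) : Set (ℕ → Fin k) :=
  ⋃ j, {ω | q.margin ≤ |scaledHits p n (scaledTime q.time n) ω j -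
      (p.prob j * q.time + scaledHits p n n ω j)|}

theorem Window.measurableSet_bad {k : ℕ} (p : Die k) (n : ℕ) (q : Window k) :
    MeasurableSet (q.bad p n) :=
  MeasurableSet.iUnion fun j => measurableSet_le (by fun_prop) (by fun_prop)

theorem Window.tendsto_measure_bad {k : ℕ} (p : Die k) (q : Window k) (hq : 0 < q.margin) :
    Tendsto (fun n => p.throwsLaw.real (q.bad p n)) atTop (𝓝 0) := by
  have h := tendsto_finsetSum (Finset.univ : Finset (Fin k)) fun j _ =>
    tendsto_measure_scaledHits_sub p j q.time hq
  rw [Finset.sum_const_zero] at h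
  refine squeeze_zero (fun _ => measureReal_nonneg) (fun n => ?_) h
  exact measureReal_iUnion_fintype_le _

theorem clearanceTime_lt_of_mem_event {k n : ℕ} (p : Die k) (hn : 0 < n) (ξ η : Allocation k n)
    (q : Window k) (hη : q.level ≤ normalized p η q.bin) {ω : ℕ → Fin k}
    (hω : (normalized p ξ, scaledHits p n n ω) ∈ q.event p) (hbad : ω ∉ q.bad p n) :
    clearanceTime ω ξ.1 < clearanceTime ω η.1 := by
  have h0 : 0 < √(n : ℝ) := Real.sqrt_pos.2 (Nat.cast_pos.2 hn)
  simp only [Window.bad, Set.mem_iUnion, Set.mem_ofPred_eq, not_exists, not_le, abs_lt] at hbad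
  obtain ⟨h₁, h₂⟩ := hω
  dsimp only at h₁ h₂
  refine clearanceTime_lt_of_hits (scaledTime q.time n) (fun j => ?_) (i := q.bin) ?_
  · have : normalized p ξ j < scaledHits p n (scaledTime q.time n) ω j := by
      linarith [h₁ j, (hbad j).1]
    rw [normalized, scaledHits, div_lt_div_iff_of_pos_right h0] at this
    have : (ξ.1 j : ℝ) ≤ hits ω (scaledTime q.time n) j := by linarith
    exact_mod_cast this
  · have : scaledHits p n (scaledTime q.time n) ω q.bin < normalized p η q.bin := by
      linarith [(hbad q.bin).2]
    rw [normalized, scaledHits, div_lt_div_iff_of_pos_right h0] at this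
    have : (hits ω (scaledTime q.time n) q.bin : ℝ) < η.1 q.bin := by linarith
    exact_mod_cast this

/-- A finite family of windows bounds the payoff from below, because each window whose level the
allocation `η` exceeds makes `η` lose. -/
theorem le_mixedPayoff_of_windows {k n : ℕ} (p : Die k) (hn : 0 < n)
    (α : ProbabilityMeasure (Allocation k n)) (η : Allocation k n) {ι : Type*} (F : Finset ι)
    (q : ι → Window k) (hη : ∀ a ∈ F, (q a).level ≤ normalized p η (q a).bin) :
    ((normalizedStrategy p α : Measure (Fin k → ℝ)).prod (scaledHitsLaw p n)).real
        (⋃ a ∈ F, (q a).event p) - ∑ a ∈ F, p.throwsLaw.real ((q a).bad p n) - 1 / 2 ≤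
      mixedPayoff p α η := by
  set V := ⋃ a ∈ F, (q a).event p with hV
  have hVm : MeasurableSet V :=
    (isOpen_biUnion fun a _ => (q a).isOpen_event p).measurableSet
  set B := ⋃ a ∈ F, (q a).bad p n with hB
  have hBm : MeasurableSet B := F.measurableSet_biUnion fun a _ => (q a).measurableSet_bad p n
  have hBle : p.throwsLaw.real B ≤ ∑ a ∈ F, p.throwsLaw.real ((q a).bad p n) :=
    measureReal_biUnion_finset_le _ _
  have hEm (ξ : Allocation k n) :
      MeasurableSet {ω | (normalized p ξ, scaledHits p n n ω) ∈ V} :=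
    (measurable_const.prodMk (measurable_scaledHits p n n)) hVm
  have hpay (ξ : Allocation k n) :
      p.throwsLaw.real {ω | (normalized p ξ, scaledHits p n n ω) ∈ V} -
        (∑ a ∈ F, p.throwsLaw.real ((q a).bad p n) + 1 / 2) ≤ payoff p ξ η := by
    have h := measureReal_sub_half_le_payoff p ξ η ((hEm ξ).diff hBm) fun ω hω => by
      obtain ⟨h₁, h₂⟩ := hω
      simp only [hV, Set.mem_iUnion, Set.mem_ofPred_eq] at h₁
      obtain ⟨a, ha, hωa⟩ := h₁
      exact clearanceTime_lt_of_mem_event p hn ξ η (q a) (hη a ha) hωa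
        fun hbad => h₂ (Set.mem_biUnion ha hbad)
    have h' := le_measureReal_sdiff (μ := p.throwsLaw) (s₂ := B)
      (s₁ := {ω | (normalized p ξ, scaledHits p n n ω) ∈ V}) (measure_ne_top _ _)
    linarith
  have hprod : ((normalizedStrategy p α : Measure (Fin k → ℝ)).prod (scaledHitsLaw p n)).real V =
      ∫ ξ, p.throwsLaw.real {ω | (normalized p ξ, scaledHits p n n ω) ∈ V}
        ∂(α : Measure (Allocation k n)) := by
    rw [measureReal_def, Measure.prod_apply hVm]
    rw [show ((normalizedStrategy p α : ProbabilityMeasure (Fin k → ℝ)) : Measure (Fin k → ℝ)) =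
      (α : Measure (Allocation k n)).map (normalized p) from rfl]
    rw [lintegral_map (measurable_measure_prodMk_left hVm) (measurable_normalized p),
      ← integral_toReal Measurable.of_discrete.aemeasurable (by simp)]
    refine integral_congr_ae (Eventually.of_forall fun ξ => ?_)
    simp only [scaledHitsLaw, ProbabilityMeasure.coe_mk]
    rw [Measure.map_apply (measurable_scaledHits p n n) (measurable_prodMk_left hVm)]
    rfl
  rw [hprod, sub_sub, mixedPayoff]
  calc _ = ∫ ξ, (p.throwsLaw.real {ω | (normalized p ξ, scaledHits p n n ω) ∈ V} -
        (∑ a ∈ F, p.throwsLaw.real ((q a).bad p n) + 1 / 2)) ∂(α : Measure (Allocation k n)) := by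
        rw [integral_sub Integrable.of_finite Integrable.of_finite]; simp
    _ ≤ _ := integral_mono Integrable.of_finite Integrable.of_finite hpay

/-- Lower semicontinuity of the winning probability: in the limit, the mixed strategy wins at least
with the probability of any countable union of windows whose levels the opponent's allocations
eventually exceed. -/
theorem eventually_lt_mixedPayoff {k : ℕ} (p : Die k)
    {α : ∀ n : ℕ, ProbabilityMeasure (Allocation k n)} {α' : ProbabilityMeasure (Fin k → ℝ)}
    (hlim : Tendsto (fun n => normalizedStrategy p (α n)) atTop (𝓝 α'))
    {l : Filter ℕ} (hl : l ≤ atTop) (η : ∀ n, Allocation k n) {ι : Type*} [Countable ι]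
    (q : ι → Window k) (hmargin : ∀ a, 0 < (q a).margin)
    (hη : ∀ a, ∀ᶠ n in l, (q a).level ≤ normalized p (η n) (q a).bin) {c : ℝ}
    (hc : c + 1 / 2 < ((α' : Measure (Fin k → ℝ)).prod (countLimitLaw p)).real
      (⋃ a, (q a).event p)) :
    ∀ᶠ n in l, c < mixedPayoff p (α n) (η n) := by
  -- The comparison in `ℝ≥0∞` below needs a nonnegative probability; payoffs are at least `-1 / 2`.
  rcases lt_or_ge (c + 1 / 2) 0 with hneg | hnn
  · filter_upwards [hl (eventually_gt_atTop 0)] with n hn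
    have := le_mixedPayoff_of_windows p hn (α n) (η n) ∅ q (by simp)
    simp at this
    linarith
  obtain ⟨F, hF⟩ : ∃ F : Finset ι, c + 1 / 2 <
      ((α' : Measure (Fin k → ℝ)).prod (countLimitLaw p)).real (⋃ a ∈ F, (q a).event p) := by
    rw [Set.iUnion_eq_iUnion_finset, measureReal_def, ← ENNReal.ofReal_lt_iff_lt_toReal hnn
      (measure_ne_top _ _), Directed.measure_iUnion, lt_iSup_iff] at hc
    · obtain ⟨F, hF⟩ := hc
      exact ⟨F, (ENNReal.ofReal_lt_iff_lt_toReal hnn (measure_ne_top _ _)).1 hF⟩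
    · exact Monotone.directed_le fun F G hFG => Set.biUnion_mono hFG fun _ _ => le_rfl
  obtain ⟨d, hcd, hd⟩ := exists_between hF
  have hopen : IsOpen (⋃ a ∈ F, (q a).event p) := isOpen_biUnion fun a _ => (q a).isOpen_event p
  have hprod : Tendsto (fun n => (normalizedStrategy p (α n)).prod (scaledHitsLaw p n)) atTop
      (𝓝 (α'.prod (countLimitLaw p))) :=
    (ProbabilityMeasure.continuous_prod.tendsto (α', countLimitLaw p)).comp
      (hlim.prodMk_nhds (tendsto_scaledHitsLaw p))
  have hport := ProbabilityMeasure.le_liminf_measure_open_of_tendsto hprod hopen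
  have hd' := (ENNReal.ofReal_lt_iff_lt_toReal (by linarith) (measure_ne_top _ _)).2 hd
  have hev := eventually_lt_of_lt_liminf (hd'.trans_le hport)
  have hbad : Tendsto (fun n => ∑ a ∈ F, p.throwsLaw.real ((q a).bad p n)) atTop (𝓝 0) := by
    simpa using tendsto_finsetSum F fun a _ => (q a).tendsto_measure_bad p (hmargin a)
  have hbad' := hbad.eventually_lt_const (sub_pos.2 hcd)
  filter_upwards [hl hev, hl hbad', hl (eventually_gt_atTop 0),
    (Filter.eventually_all_finset F).2 fun a _ => hη a] with n h₁ h₂ h₃ h₄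
  have h₅ := (ENNReal.ofReal_lt_iff_lt_toReal (by linarith) (measure_ne_top _ _)).1 h₁
  have h₆ := le_mixedPayoff_of_windows p h₃ (α n) (η n) F q h₄
  rw [measureReal_def] at h₆
  rw [ProbabilityMeasure.toMeasure_prod] at h₅
  linarith

/-! ### The continuous game -/

theorem measurable_contClearanceTime {k : ℕ} (p : Die k) :
    Measurable fun r : (Fin k → ℝ) × (Fin k → ℝ) => contClearanceTime p r.2 r.1 := by
  unfold contClearanceTime
  exact Measurable.iSup fun i => by fun_prop

theorem contClearanceTime_lt_iff {k : ℕ} (p : Die k) (z x : Fin k → ℝ) (a : ℝ) :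
    contClearanceTime p z x < a ↔ ∀ i, x i / p.prob i + z i / √(p.prob i) < a := by
  have := p.nonempty_sides
  refine ⟨fun h i => (le_ciSup (Set.finite_range _).bddAbove i).trans_lt h, fun h => ?_⟩
  obtain ⟨i, hi⟩ := exists_eq_ciSup_of_finite (f := fun i => x i / p.prob i + z i / √(p.prob i))
  rw [contClearanceTime, ← hi]
  exact h i

theorem exists_eq_contClearanceTime {k : ℕ} (p : Die k) (z x : Fin k → ℝ) :
    ∃ i, x i / p.prob i + z i / √(p.prob i) = contClearanceTime p z x :=
  have := p.nonempty_sides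
  exists_eq_ciSup_of_finite (f := fun i => x i / p.prob i + z i / √(p.prob i))

theorem measure_add_div_eq_zero {k : ℕ} (p : Die k) {i j : Fin k} (hij : i ≠ j) (a b : ℝ) :
    stdNormal k {z | a + z i / √(p.prob i) = b + z j / √(p.prob j)} = 0 := by
  have hind : IndepFun (fun z : Fin k → ℝ => z i) (fun z => z j) (stdNormal k) :=
    (iIndepFun_pi (X := fun _ => id) (μ := fun _ : Fin k => gaussianReal 0 1)
      fun _ => aemeasurable_id).indepFun hij
  have hmap := (indepFun_iff_map_prod_eq_prod_map_map
    (measurable_pi_apply i).aemeasurable (measurable_pi_apply j).aemeasurable).1 hind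
  rw [(measurePreserving_eval (fun _ : Fin k => gaussianReal 0 1) i).map_eq,
    (measurePreserving_eval (fun _ : Fin k => gaussianReal 0 1) j).map_eq] at hmap
  have hS : MeasurableSet {r : ℝ × ℝ | a + r.1 / √(p.prob i) = b + r.2 / √(p.prob j)} :=
    measurableSet_eq_fun (by fun_prop) (by fun_prop)
  have hnull : ((gaussianReal 0 1).prod (gaussianReal 0 1))
      {r : ℝ × ℝ | a + r.1 / √(p.prob i) = b + r.2 / √(p.prob j)} = 0 := by
    rw [Measure.measure_prod_null hS]
    refine Eventually.of_forall fun u => ?_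
    have : NullSingletonClass (gaussianReal 0 1) := nullSingletonClass_gaussianReal one_ne_zero
    refine measure_mono_null (t := {(a + u / √(p.prob i) - b) * √(p.prob j)}) (fun v hv => ?_)
      (measure_singleton _)
    have h0 := Real.sqrt_pos.2 (p.prob_pos j)
    have hv' : a + u / √(p.prob i) = b + v / √(p.prob j) := hv
    rw [Set.mem_singleton_iff, hv']
    field_simp
    ring
  rw [← hmap, Measure.map_apply (by fun_prop) hS] at hnull
  exact hnull

/-- Two allocations that differ in every bin almost surely do not tie. -/
theorem measure_contClearanceTime_eq {k : ℕ} (p : Die k) {x y : Fin k → ℝ} (h : ∀ i, x i ≠ y i) :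
    stdNormal k {z | contClearanceTime p z x = contClearanceTime p z y} = 0 := by
  refine measure_mono_null (t := ⋃ i, ⋃ j, {z | x i / p.prob i + z i / √(p.prob i) =
    y j / p.prob j + z j / √(p.prob j)}) (fun z hz => ?_)
    (measure_iUnion_null fun i => measure_iUnion_null fun j => ?_)
  · obtain ⟨i, hi⟩ := exists_eq_contClearanceTime p z x
    obtain ⟨j, hj⟩ := exists_eq_contClearanceTime p z y
    simp only [Set.mem_iUnion]
    exact ⟨i, j, hi.trans (Eq.trans hz hj.symm)⟩
  · rcases eq_or_ne i j with rfl | hij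
    · have : {z : Fin k → ℝ | x i / p.prob i + z i / √(p.prob i) =
          y i / p.prob i + z i / √(p.prob i)} = ∅ := by
        ext z
        simp [(p.prob_pos i).ne', div_left_inj', h i]
      rw [this, measure_empty]
    · exact measure_add_div_eq_zero p hij _ _

theorem contPayoff_eq_of_ne {k : ℕ} (p : Die k) {x y : Fin k → ℝ} (h : ∀ i, x i ≠ y i) :
    contPayoff p x y =
      (stdNormal k).real {z | contClearanceTime p z x < contClearanceTime p z y} - 1 / 2 := by
  have hx : Measurable fun z => contClearanceTime p z x :=
    (measurable_contClearanceTime p).comp measurable_prodMk_left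
  have hy : Measurable fun z => contClearanceTime p z y :=
    (measurable_contClearanceTime p).comp measurable_prodMk_left
  have h₁ : (stdNormal k).real {z | contClearanceTime p z y < contClearanceTime p z x} =
      (stdNormal k).real {z | contClearanceTime p z x < contClearanceTime p z y}ᶜ := by
    refine measureReal_congr ?_
    have hne : ∀ᵐ z ∂stdNormal k, contClearanceTime p z x ≠ contClearanceTime p z y :=
      measure_eq_zero_iff_ae_notMem.1 <| measure_contClearanceTime_eq p h
    filter_upwards [hne] with z hz
    refine propext (⟨fun hlt => not_lt.2 hlt.le, fun hge => ?_⟩)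
    exact lt_of_le_of_ne (not_lt.1 hge) hz.symm
  rw [probReal_compl_eq_one_sub (measurableSet_lt hx hy)] at h₁
  unfold contPayoff
  rw [h₁]
  ring

theorem abs_contPayoff_le {k : ℕ} (p : Die k) (x y : Fin k → ℝ) : |contPayoff p x y| ≤ 1 / 2 := by
  have h₁ := measureReal_nonneg (μ := stdNormal k)
    (s := {z | contClearanceTime p z x < contClearanceTime p z y})
  have h₂ := measureReal_nonneg (μ := stdNormal k)
    (s := {z | contClearanceTime p z y < contClearanceTime p z x})
  have h₃ := measureReal_le_one (μ := stdNormal k)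
    (s := {z | contClearanceTime p z x < contClearanceTime p z y})
  have h₄ := measureReal_le_one (μ := stdNormal k)
    (s := {z | contClearanceTime p z y < contClearanceTime p z x})
  unfold contPayoff
  rw [abs_le]
  constructor <;> linarith

theorem abs_contMixedPayoff_le {k : ℕ} (p : Die k) (α : ProbabilityMeasure (Fin k → ℝ))
    (y : Fin k → ℝ) : |contMixedPayoff p α y| ≤ 1 / 2 := by
  have := norm_integral_le_of_norm_le_const (μ := (α : Measure (Fin k → ℝ)))
    (f := fun x => contPayoff p x y) (C := 1 / 2)
    (Eventually.of_forall fun x => by simpa using abs_contPayoff_le p x y)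
  simpa [contMixedPayoff] using this

theorem contMixedPayoff_eq {k : ℕ} (p : Die k) {α : ProbabilityMeasure (Fin k → ℝ)}
    (hα : HasAtomlessMarginals α) (y : Fin k → ℝ) :
    contMixedPayoff p α y = ((α : Measure (Fin k → ℝ)).prod (stdNormal k)).real
      {r | contClearanceTime p r.2 r.1 < contClearanceTime p r.2 y} - 1 / 2 := by
  have hne : ∀ᵐ x ∂(α : Measure (Fin k → ℝ)), ∀ i, x i ≠ y i := by
    refine ae_all_iff.2 fun i => ?_
    have := hα i (y i)
    rw [Measure.map_apply (measurable_pi_apply i) (measurableSet_singleton _)] at this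
    exact measure_eq_zero_iff_ae_notMem.1 this
  have hS : MeasurableSet {r : (Fin k → ℝ) × (Fin k → ℝ) |
      contClearanceTime p r.2 r.1 < contClearanceTime p r.2 y} :=
    measurableSet_lt (measurable_contClearanceTime p) ((measurable_contClearanceTime p).comp
      (measurable_const.prodMk measurable_snd))
  have hmeas := measurable_measure_prodMk_left (ν := stdNormal k) hS
  have hint : Integrable (fun x => (stdNormal k).real
      {z | contClearanceTime p z x < contClearanceTime p z y}) (α : Measure (Fin k → ℝ)) :=
    Integrable.of_bound hmeas.ennreal_toReal.aestronglyMeasurable 1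
      (Eventually.of_forall fun x => by
        rw [Real.norm_of_nonneg measureReal_nonneg]; exact measureReal_le_one)
  rw [contMixedPayoff, integral_congr_ae (hne.mono fun x hx => contPayoff_eq_of_ne p hx),
    integral_sub hint (integrable_const _), measureReal_def (α.toMeasure.prod _),
    Measure.prod_apply hS, ← integral_toReal hmeas.aemeasurable (by simp)]
  simp [measureReal_def]

theorem Window.exists_mem_event {k : ℕ} (p : Die k) {x g : Fin k → ℝ} {s c : ℝ} {i : Fin k}
    (h : ∀ j, x j < p.prob j * s + g j) (hi : p.prob i * s + g i < c) :
    ∃ m : ℕ, (x, g) ∈ (Window.mk s c (1 / (m + 1)) i).event p := by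
  have hlim := tendsto_one_div_add_atTop_nhds_zero_nat (𝕜 := ℝ)
  have h₁ : ∀ᶠ m : ℕ in atTop, ∀ j, (1 : ℝ) / (m + 1) < p.prob j * s + g j - x j :=
    eventually_all.2 fun j => hlim.eventually_lt_const (sub_pos.2 (h j))
  have h₂ : ∀ᶠ m : ℕ in atTop, (1 : ℝ) / (m + 1) < c - (p.prob i * s + g i) :=
    hlim.eventually_lt_const (sub_pos.2 hi)
  obtain ⟨m, hm₁, hm₂⟩ := (h₁.and h₂).exists
  exact ⟨m, fun j => by have := hm₁ j; dsimp only; linarith, by dsimp only; linarith⟩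

/-- If the opponent stakes too much on one bin, every outcome of the limiting counts is won: at a
late time all bins of `x` are empty and the overloaded bin is not. -/
theorem exists_mem_event_of_bin {k : ℕ} (p : Die k) (i : Fin k) (r : (Fin k → ℝ) × (Fin k → ℝ)) :
    ∃ (s c : ℚ) (m : ℕ), r ∈ (Window.mk s c (1 / (m + 1)) i).event p := by
  obtain ⟨M, hM⟩ := (Set.finite_range fun j => (r.1 j - r.2 j) / p.prob j).bddAbove
  obtain ⟨s, hs⟩ := exists_rat_gt M
  obtain ⟨c, hc⟩ := exists_rat_gt (p.prob i * s + r.2 i)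
  obtain ⟨m, hm⟩ := Window.exists_mem_event p (x := r.1) (g := r.2) (s := s) (c := c) (i := i)
    (fun j => by
      have := (hM ⟨j, rfl⟩).trans_lt hs
      rw [div_lt_iff₀ (p.prob_pos j)] at this
      linarith) hc
  exact ⟨s, c, m, hm⟩

/-- Winning in the continuous game is witnessed by a window with rational parameters whose level
lies below the opponent's allocation. -/
theorem exists_mem_event_of_contClearanceTime_lt {k : ℕ} (p : Die k) {x y z : Fin k → ℝ}
    (h : contClearanceTime p z x < contClearanceTime p z y) :
    ∃ (s c : ℚ) (m : ℕ) (i : Fin k), (c : ℝ) < y i ∧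
      (x, countLimit p z) ∈ (Window.mk s c (1 / (m + 1)) i).event p := by
  -- The shift between the clearance times of the continuous game and of the limiting counts.
  set w := ∑ j, √(p.prob j) * z j with hw
  obtain ⟨s, hs₁, hs₂⟩ := exists_rat_btwn (sub_lt_sub_right h w)
  have key (j : Fin k) (u : ℝ) : u / p.prob j + z j / √(p.prob j) =
      (u - countLimit p z j) / p.prob j + w := by
    have h0 := p.prob_pos j
    have h1 := Real.sqrt_pos.2 h0
    have h2 : √(p.prob j) / p.prob j = 1 / √(p.prob j) := by
      rw [Real.sqrt_div_self]; simp
    simp only [countLimit, ← hw]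
    have h3 : (u - (p.prob j * w - √(p.prob j) * z j)) / p.prob j =
        u / p.prob j - w + √(p.prob j) / p.prob j * z j := by
      field_simp
      ring
    rw [h3, h2]
    ring
  have hx := (contClearanceTime_lt_iff p z x (s + w)).1 (by linarith)
  obtain ⟨i, hi⟩ := exists_eq_contClearanceTime p z y
  have hyi : p.prob i * s + countLimit p z i < y i := by
    rw [key] at hi
    have : (s : ℝ) < (y i - countLimit p z i) / p.prob i := by linarith
    rw [lt_div_iff₀ (p.prob_pos i)] at this
    linarith
  obtain ⟨c, hc₁, hc₂⟩ := exists_rat_btwn hyi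
  obtain ⟨m, hm⟩ := Window.exists_mem_event p (x := x) (g := countLimit p z) (s := s) (c := c)
    (i := i) (fun j => by
      have := hx j
      rw [key] at this
      have : (x j - countLimit p z j) / p.prob j < s := by linarith
      rw [div_lt_iff₀ (p.prob_pos j)] at this
      linarith) hc₁
  exact ⟨s, c, m, i, hc₂, hm⟩

/-! ### Passage to the limit -/

section Limit

variable {k : ℕ} (p : Die k) {α : ∀ n : ℕ, ProbabilityMeasure (Allocation k n)}
  {α' : ProbabilityMeasure (Fin k → ℝ)}

theorem eventually_lt_mixedPayoff_of_tendsto_atTop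
    (hlim : Tendsto (fun n => normalizedStrategy p (α n)) atTop (𝓝 α'))
    {l : Filter ℕ} (hl : l ≤ atTop) (η : ∀ n, Allocation k n) {i : Fin k}
    (hη : Tendsto (fun n => normalized p (η n) i) l atTop) {c : ℝ} (hc : c < 1 / 2) :
    ∀ᶠ n in l, c < mixedPayoff p (α n) (η n) := by
  refine eventually_lt_mixedPayoff p hlim hl η
    (fun a : ℚ × ℚ × ℕ => ⟨a.1, a.2.1, 1 / (a.2.2 + 1), i⟩) (fun a => by positivity)
    (fun a => hη.eventually_ge_atTop _) ?_
  have huniv : (⋃ a : ℚ × ℚ × ℕ, (Window.mk a.1 a.2.1 (1 / (a.2.2 + 1)) i).event p) =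
      Set.univ := by
    refine Set.eq_univ_of_forall fun r => ?_
    obtain ⟨s, c, m, h⟩ := exists_mem_event_of_bin p i r
    exact Set.mem_iUnion.2 ⟨(s, c, m), h⟩
  rw [huniv, probReal_univ]
  linarith

theorem eventually_lt_mixedPayoff_of_tendsto (hatomless : HasAtomlessMarginals α')
    (hlim : Tendsto (fun n => normalizedStrategy p (α n)) atTop (𝓝 α'))
    {l : Filter ℕ} (hl : l ≤ atTop) (η : ∀ n, Allocation k n) {y : Fin k → ℝ}
    (hη : Tendsto (fun n => normalized p (η n)) l (𝓝 y)) {c : ℝ}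
    (hc : c < contMixedPayoff p α' y) :
    ∀ᶠ n in l, c < mixedPayoff p (α n) (η n) := by
  refine eventually_lt_mixedPayoff p hlim hl η
    (fun a : {a : ℚ × ℚ × ℕ × Fin k // (a.2.1 : ℝ) < y a.2.2.2} =>
      ⟨a.1.1, a.1.2.1, 1 / (a.1.2.2.1 + 1), a.1.2.2.2⟩) (fun a => by positivity)
    (fun a => ((tendsto_pi_nhds.1 hη _).eventually_const_lt a.2).mono fun n hn => hn.le) ?_
  rw [contMixedPayoff_eq p hatomless] at hc
  refine (lt_sub_iff_add_lt.1 hc).trans_le ?_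
  set U := ⋃ a : {a : ℚ × ℚ × ℕ × Fin k // (a.2.1 : ℝ) < y a.2.2.2},
    (Window.mk a.1.1 a.1.2.1 (1 / (a.1.2.2.1 + 1)) a.1.2.2.2).event p with hU
  have hUm : MeasurableSet U := (isOpen_iUnion fun a => Window.isOpen_event p _).measurableSet
  have hmap : (α' : Measure (Fin k → ℝ)).prod (countLimitLaw p : Measure (Fin k → ℝ)) =
      ((α' : Measure (Fin k → ℝ)).prod (stdNormal k)).map (Prod.map id (countLimit p)) := by
    rw [← Measure.map_prod_map _ _ measurable_id (measurable_countLimit p), Measure.map_id]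
    rfl
  rw [hmap, map_measureReal_apply (by fun_prop) hUm]
  refine measureReal_mono fun r hr => ?_
  obtain ⟨s, c, m, i, hci, hmem⟩ := exists_mem_event_of_contClearanceTime_lt p hr
  exact Set.mem_iUnion.2 ⟨⟨(s, c, m, i), hci⟩, hmem⟩

theorem sum_normalized {n : ℕ} (ξ : Allocation k n) : ∑ i, normalized p ξ i = 0 := by
  have h : ∑ i, (ξ.1 i : ℝ) = n := by exact_mod_cast ξ.2
  simp only [normalized]
  rw [← Finset.sum_div, Finset.sum_sub_distrib, ← Finset.sum_mul, p.sum_prob, h]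
  simp

end Limit

/-- Along an ultrafilter, vectors of sum zero converge or have a coordinate that tends to `∞`. -/
theorem exists_tendsto_or_tendsto_atTop {k : ℕ} {ι : Type*} (u : Ultrafilter ι)
    (v : ι → Fin k → ℝ) (hv : ∀ n, ∑ i, v n i = 0) :
    (∃ i, Tendsto (fun n => v n i) u atTop) ∨
      ∃ y : Fin k → ℝ, ∑ i, y i = 0 ∧ Tendsto v u (𝓝 y) := by
  refine or_iff_not_imp_left.2 fun h => ?_
  have hbdd : ∀ i, ∃ C, ∀ᶠ n in (u : Filter ι), v n i ≤ C := by
    intro i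
    by_contra! hC
    refine h ⟨i, tendsto_atTop.2 fun C => ?_⟩
    exact (hC C).mono fun n hn => hn.le
  choose C hC using hbdd
  have hCall : ∀ᶠ n in (u : Filter ι), ∀ i, v n i ≤ C i := eventually_all.2 hC
  -- A coordinate is the negative of the sum of the others, which are bounded above.
  have hmem : ∀ᶠ n in (u : Filter ι), v n ∈ Set.Icc (fun i => C i - ∑ j, C j) C := by
    filter_upwards [hCall] with n hn
    refine ⟨fun i => ?_, hn⟩
    have := Finset.single_le_sum (f := fun j => C j - v n j) (fun j _ => sub_nonneg.2 (hn j))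
      (Finset.mem_univ i)
    rw [Finset.sum_sub_distrib, hv] at this
    dsimp only at this ⊢
    linarith
  obtain ⟨y, -, hy⟩ := isCompact_Icc.ultrafilter_le_nhds (u.map v) (le_principal_iff.2 hmem)
  have hy' : Tendsto v u (𝓝 y) := hy
  refine ⟨y, ?_, hy'⟩
  have hsum := tendsto_finsetSum Finset.univ fun i _ => tendsto_pi_nhds.1 hy' i
  simp only [hv] at hsum
  exact tendsto_nhds_unique hsum tendsto_const_nhds

theorem abs_mixedPayoff_le {k n : ℕ} (p : Die k) (α : ProbabilityMeasure (Allocation k n))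
    (η : Allocation k n) : |mixedPayoff p α η| ≤ 1 / 2 := by
  have hpay (ξ : Allocation k n) : |payoff p ξ η| ≤ 1 / 2 := by
    have h₁ := measureReal_nonneg (μ := p.throwsLaw)
      (s := {ω | clearanceTime ω ξ.1 < clearanceTime ω η.1})
    have h₂ := measureReal_nonneg (μ := p.throwsLaw)
      (s := {ω | clearanceTime ω η.1 < clearanceTime ω ξ.1})
    have h₃ := measureReal_le_one (μ := p.throwsLaw)
      (s := {ω | clearanceTime ω ξ.1 < clearanceTime ω η.1})
    have h₄ := measureReal_le_one (μ := p.throwsLaw)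
      (s := {ω | clearanceTime ω η.1 < clearanceTime ω ξ.1})
    unfold payoff
    rw [abs_le]
    constructor <;> linarith
  have := norm_integral_le_of_norm_le_const (μ := (α : Measure (Allocation k n)))
    (f := fun ξ => payoff p ξ η) (C := 1 / 2)
    (Eventually.of_forall fun ξ => by simpa using hpay ξ)
  simpa [mixedPayoff] using this

/-- The comparison of worst-case payoffs. If the worst-case payoffs were frequently below
some `c` less than the left-hand side, the opponent's best replies could be followed along an
ultrafilter on which they keep the payoff below `c`. -/
theorem iInf_contMixedPayoff_le_liminf_worstPayoff {k : ℕ} (p : Die k)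
    {α : ∀ n : ℕ, ProbabilityMeasure (Allocation k n)} {α' : ProbabilityMeasure (Fin k → ℝ)}
    (hatomless : HasAtomlessMarginals α')
    (hlim : Tendsto (fun n => normalizedStrategy p (α n)) atTop (𝓝 α')) :
    (⨅ y : ContAllocation k, contMixedPayoff p α' y.1) ≤
      liminf (fun n => worstPayoff p (α n)) atTop := by
  choose η hη _ using fun n => exists_mixedPayoff_eq_worstPayoff p (α n)
  have hbdd : BddBelow (Set.range fun y : ContAllocation k => contMixedPayoff p α' y.1) :=
    ⟨-(1 / 2), by rintro _ ⟨y, rfl⟩; exact (abs_le.1 (abs_contMixedPayoff_le p α' y.1)).1⟩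
  have hhalf : ⨅ y : ContAllocation k, contMixedPayoff p α' y.1 ≤ 1 / 2 :=
    (ciInf_le hbdd ⟨0, by simp⟩).trans (abs_le.1 (abs_contMixedPayoff_le p α' _)).2
  have hcobdd : IsCoboundedUnder (· ≥ ·) atTop fun n => worstPayoff p (α n) :=
    (isBoundedUnder_of ⟨1 / 2, fun n => by
      rw [← hη n]; exact (abs_le.1 (abs_mixedPayoff_le p (α n) (η n))).2⟩).isCoboundedUnder_ge
  refine le_of_forall_lt_imp_le_of_dense fun c hc => le_liminf_of_le hcobdd ?_
  by_contra hfreq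
  have hne : (atTop ⊓ 𝓟 {n | ¬ c ≤ worstPayoff p (α n)}).NeBot :=
    frequently_iff_neBot.1 (not_eventually.1 hfreq)
  set u := Ultrafilter.of (atTop ⊓ 𝓟 {n | ¬ c ≤ worstPayoff p (α n)}) with hu
  have hle := Ultrafilter.of_le (atTop ⊓ 𝓟 {n | ¬ c ≤ worstPayoff p (α n)})
  have hatTop : (u : Filter ℕ) ≤ atTop := hle.trans inf_le_left
  have hlt : ∀ᶠ n in (u : Filter ℕ), ¬ c ≤ worstPayoff p (α n) :=
    le_principal_iff.1 (hle.trans inf_le_right)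
  have hgt : ∀ᶠ n in (u : Filter ℕ), c < mixedPayoff p (α n) (η n) := by
    rcases exists_tendsto_or_tendsto_atTop u (fun n => normalized p (η n))
      fun n => sum_normalized p (η n) with ⟨i, hi⟩ | ⟨y, hy, htend⟩
    · exact eventually_lt_mixedPayoff_of_tendsto_atTop p hlim hatTop η hi (hc.trans_le hhalf)
    · exact eventually_lt_mixedPayoff_of_tendsto p hatomless hlim hatTop η htend
        (hc.trans_le (ciInf_le hbdd ⟨y, hy⟩))
  obtain ⟨n, h₁, h₂⟩ := (hlt.and hgt).exists
  exact h₁ (hη n ▸ h₂.le)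

end KnockEmDown

end

theorem theorem4p1 {k : ℕ} (p : KnockEmDown.Die k)
    (α : ∀ n : ℕ, ProbabilityMeasure (KnockEmDown.Allocation k n))
    (α' : ProbabilityMeasure (Fin k → ℝ))
    (hstrategy : KnockEmDown.IsContStrategy α')
    (hatomless : KnockEmDown.HasAtomlessMarginals α')
    (hbounded : Bornology.IsBounded (α' : Measure (Fin k → ℝ)).support)
    (hlim : Tendsto (fun n => KnockEmDown.normalizedStrategy p (α n)) atTop (𝓝 α')) :
    (⨅ y : KnockEmDown.ContAllocation k, KnockEmDown.contMixedPayoff p α' y.1) ≤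
      liminf (fun n => KnockEmDown.worstPayoff p (α n)) atTop :=
  KnockEmDown.iInf_contMixedPayoff_le_liminf_worstPayoff p hatomless hlim
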